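/- An extensional $\mathbf{BC^{\pm}I}$-algebra is a set $\mathcal A$ with a binary application (written by juxtaposition, associating to the left) and elements $B, C^+, C^-, I$ such that, writing $a\circ b = B\,a\,b$, for all $a,b,c\in\mathcal A$ (signs $\pm,\mp$ linked, $\star$ an arbitrary sign): $B\,a\,b\,c=a\,(b\,c)$; $C^\star a\,b\,c=a\,c\,b$; $I\,a=a$; $C^+a\,b=C^-a\,b$; $B\,I=I$; $C^\star B\,I=B\,I$; $(C^\star B\,B)\circ(B\circ B)=(B\,B)\circ B$; $C^\pm\circ C^\mp=B\,(B\,I)$; $(C^\star B\,C^\pm)\circ(B\circ B)=(B\,C^\pm)\circ(B\circ B)$; $(B\,C^\pm)\circ(C^\pm\circ(B\,C^\pm))=C^\pm\circ((B\,C^\pm)\circ C^\pm)$; $(B\,B)\circ C^\pm=C^\pm\circ((B\,C^\pm)\circ B)$. It is balanced if it is equipped with elements $\theta^+,\theta^-$ such that $(B\,\theta^\pm)\circ B=(C^\star B\,\theta^\pm)\circ B$; $\theta^\pm\circ\theta^\mp=B\,I$; $C^\star\theta^\star a=C^\star I\,a$ for all $a$ (the signs $\star$ being chosen independently); $B\circ\theta^\pm=\theta^\pm\circ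 C^\pm\circ\theta^\pm\circ C^\pm\circ B$. A balanced extensional $\mathbf{BC^{\pm}I}$-algebra is traced if it is moreover equipped with an element $Tr$ such that (left tightening) $(C^\star B\,Tr)\circ B=(B\,Tr)\circ B^2$; (right tightening) $(B\,Tr)\circ(C^\star B\,B)\circ B=B\circ Tr$; (yanking) $Tr\,C^\pm=\theta^\pm$; (exchange) $Tr^2\circ(C^\star B\,C^-)\circ(B\,C^+)=Tr^2$, where $a^0=I$ and $a^{n+1}=a\circ a^n$. Put $a^\bullet=C^+I\,a$. An element $a$ has arity $m\to n$ if $a^\bullet\circ B^{m+1}=(B\,a)\circ B^n$. The internal PROB $\mathcal I_{\mathcal A}$ is the strict balanced monoidal category with objects the natural numbers, morphisms $m\to n$ the elements of arity $m\to n$, composition $a;b=a\circ b$, identities $I$, tensor $m\otimes n=m+n$ on objects, $l\otimes a=B^l a$ (apply $B$ to $a$ $l$ times) and $a\otimes l=a$ on morphisms; braid $\sigma_{m,n}$ given by $\sigma_{0,1}=I$, $\sigma_{m+1,1}=(B\,\sigma_{m,1})\circ C^+$, $\sigma_{m,0}=I$, $\sigma_{m,n+1}=\sigma_{m,1}\circ(B\,\sigma_{m,n})$;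 and twist $\theta_0=I$, $\theta_{m+1}=\theta^+\circ\sigma_{1,m}\circ\theta_m\circ\sigma_{m,1}$. A (right) trace on a balanced monoidal category is a family of maps $\mathrm{Tr}^X_{A,B}\colon \mathrm{Hom}(A\otimes X,B\otimes X)\to \mathrm{Hom}(A,B)$ satisfying tightening (naturality in $A$ and $B$), sliding (dinaturality in $X$), vanishing (for the unit and for $X\otimes Y$), superposing ($\mathrm{Tr}^X(Z\otimes f)=Z\otimes\mathrm{Tr}^X(f)$) and yanking ($\mathrm{Tr}^X(\sigma_{X,X}^{\pm1})=\theta_X^{\pm1}$). Its associated left trace sends $f\colon X\otimes A\to X\otimes B$ to $\mathrm{Tr}_L^X(f)=\mathrm{Tr}^X(\sigma_{X,A}^{-1};f;\sigma_{X,B})\colon A\to B$. Proposition. Let $\mathcal A$ be a traced balanced extensional $\mathbf{BC^{\pm}I}$-algebra. Then $\mathcal I_{\mathcal A}$ is a traced balanced monoidal category: it has a trace whose associated left trace is given by application of $Tr$, that is, for $f\colon 1+m\to 1+n$ one has $\mathrm{Tr}_L^1(f)=Tr\,f\colon m\to n$, and, more generally, for $f\colon k+m\to k+n$ the left trace $\mathrm{Tr}_L^k(f)\colon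 m\to n$ is obtained by applying $Tr$ to $f$ $k$ times. -/

import Mathlib

open CategoryTheory MonoidalCategory

universe u v w

/-- A sign, used to index the two braid combinators and the two twist combinators. -/
inductive Sgn where
  | pos
  | neg

/-- The opposite sign. -/
def Sgn.flip : Sgn → Sgn
  | .pos => .neg
  | .neg => .pos

/-- An applicative structure: a set with a binary application. -/
class ApplicativeStructure (A : Type u) where
  app : A → A → A

infixl:100 " ⬝ " => ApplicativeStructure.app

/-- An applicative structure with distinguished elements `B`, `C⁺`, `C⁻`, `I`. -/
class BCISignature (A : Type u) extends ApplicativeStructure A where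
  B : A
  C : Sgn → A
  I : A

namespace BCI

open BCISignature

section
variable {A : Type u} [BCISignature A]

/-- `a ∘ b` abbreviates `B a b` (first `a`, then `b`, for elements with arity). -/
def comp (a b : A) : A := B ⬝ a ⬝ b

/-- `a⁰ = I` and `aⁿ⁺¹ = a ∘ aⁿ`. -/
def cpow (a : A) : ℕ → A
  | 0 => I
  | n + 1 => comp a (cpow a n)

/-- `a• = C⁺ I a`, so that `a• b = b a`. -/
def dot (a : A) : A := C Sgn.pos ⬝ I ⬝ a

end

end BCI

infixr:90 " ⊚ " => BCI.comp

open BCI BCISignature in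
/-- Extensional `BC±I`-algebras. -/
class ExtBCIAlgebra (A : Type u) extends BCISignature A where
  ax_B : ∀ a b c : A, B ⬝ a ⬝ b ⬝ c = a ⬝ (b ⬝ c)
  ax_C : ∀ (s : Sgn) (a b c : A), C s ⬝ a ⬝ b ⬝ c = a ⬝ c ⬝ b
  ax_I : ∀ a : A, I ⬝ a = a
  ax_C2 : ∀ a b : A, C Sgn.pos ⬝ a ⬝ b = C Sgn.neg ⬝ a ⬝ b
  ax_lambda : (B : A) ⬝ I = I
  ax_rho : ∀ s : Sgn, (C s : A) ⬝ B ⬝ I = B ⬝ I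
  ax_alpha : ∀ s : Sgn, ((C s : A) ⬝ B ⬝ B) ⊚ (B ⊚ B) = (B ⬝ B) ⊚ B
  ax_cox1 : ∀ s : Sgn, (C s : A) ⊚ C s.flip = B ⬝ (B ⬝ I)
  ax_cox2 : ∀ s t : Sgn, ((C s : A) ⬝ B ⬝ C t) ⊚ (B ⊚ B) = (B ⬝ C t) ⊚ (B ⊚ B)
  ax_cox3 : ∀ s : Sgn, (B ⬝ (C s : A)) ⊚ (C s ⊚ (B ⬝ C s)) = C s ⊚ ((B ⬝ C s) ⊚ C s)
  ax_bc : ∀ s : Sgn, (B ⬝ (B : A)) ⊚ C s = C s ⊚ ((B ⬝ C s) ⊚ B)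

open BCI BCISignature in
/-- Balanced extensional `BC±I`-algebras: `θ pos` and `θ neg` are the twist combinators. -/
class BalancedExtBCIAlgebra (A : Type u) extends ExtBCIAlgebra A where
  θ : Sgn → A
  ax_θ1 : ∀ s t : Sgn, (B ⬝ θ s) ⊚ B = (C t ⬝ B ⬝ θ s) ⊚ B
  ax_θ2 : ∀ s : Sgn, θ s ⊚ θ s.flip = B ⬝ I
  ax_θ3 : ∀ (s t r : Sgn) (a : A), C s ⬝ θ t ⬝ a = C r ⬝ I ⬝ a
  ax_θ4 : ∀ s : Sgn, B ⊚ θ s = θ s ⊚ C s ⊚ θ s ⊚ C s ⊚ B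

open BCI BCISignature BalancedExtBCIAlgebra in
/-- Traced (balanced) extensional `BC±I`-algebras, with trace combinator `Tr`. -/
class TracedExtBCIAlgebra (A : Type u) extends BalancedExtBCIAlgebra A where
  Tr : A
  left_tightening : ∀ s : Sgn, (C s ⬝ B ⬝ Tr) ⊚ B = (B ⬝ Tr) ⊚ cpow B 2
  right_tightening : ∀ s : Sgn, (B ⬝ Tr) ⊚ (C s ⬝ B ⬝ B) ⊚ B = B ⊚ Tr
  yanking : ∀ s : Sgn, Tr ⬝ C s = θ s
  exchange : ∀ s : Sgn,
    cpow Tr 2 ⊚ (C s ⬝ B ⬝ C Sgn.neg) ⊚ (B ⬝ C Sgn.pos) = cpow Tr 2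

namespace BCI

open BCISignature

section Arity
variable {A : Type u} [BCISignature A]

/-- `a` has arity `m → n` when `a• ∘ Bᵐ⁺¹ = (B a) ∘ Bⁿ`. -/
def HasArity (a : A) (m n : ℕ) : Prop :=
  dot a ⊚ cpow B (m + 1) = (B ⬝ a) ⊚ cpow B n

/-- `lwhisk l a = Bˡ a`, the element `l + a`: apply `B` to `a` exactly `l` times. -/
def lwhisk (l : ℕ) (a : A) : A := (fun x => B ⬝ x)^[l] a

/-- `σ_{1,n}` for the braid combinator `C s`. -/
def braidOne (s : Sgn) : ℕ → A
  | 0 => I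
  | n + 1 => C s ⊚ (B ⬝ braidOne s n)

/-- `σ_{m,1}`: `σ_{0,1} = I` and `σ_{m+1,1} = (B σ_{m,1}) ∘ C`. -/
def oneBraid (s : Sgn) : ℕ → A
  | 0 => I
  | m + 1 => (B ⬝ oneBraid s m) ⊚ C s

/-- `σ_{m,n}`: `σ_{m,0} = I` and `σ_{m,n+1} = σ_{m,1} ∘ (B σ_{m,n})`. -/
def braid (m : ℕ) : ℕ → A
  | 0 => I
  | n + 1 => oneBraid Sgn.pos m ⊚ (B ⬝ braid m n)

/-- The inverse of `σ_{m,n}`. -/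
def braidInv (m : ℕ) : ℕ → A
  | 0 => I
  | n + 1 => (B ⬝ braidInv m n) ⊚ braidOne Sgn.neg m

end Arity

/-- The twist: `θ₀ = I` and `θ_{m+1} = θ⁺ ∘ σ_{1,m} ∘ θ_m ∘ σ_{m,1}`. -/
def twist {A : Type u} [BalancedExtBCIAlgebra A] : ℕ → A
  | 0 => I
  | m + 1 => BalancedExtBCIAlgebra.θ Sgn.pos ⊚ braid 1 m ⊚ twist m ⊚ braid m 1

/-- The inverse of the twist. -/
def twistInv {A : Type u} [BalancedExtBCIAlgebra A] : ℕ → A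
  | 0 => I
  | m + 1 => braidInv m 1 ⊚ twistInv m ⊚ braidInv 1 m ⊚ BalancedExtBCIAlgebra.θ Sgn.neg

section Lemmas
variable {A : Type u} [ExtBCIAlgebra A]
open ExtBCIAlgebra

theorem comp_app (a b c : A) : (a ⊚ b) ⬝ c = a ⬝ (b ⬝ c) := ax_B a b c

theorem C_eq (s t : Sgn) (a b : A) : C s ⬝ a ⬝ b = C t ⬝ a ⬝ b := by
  cases s <;> cases t <;> simp [ax_C2]

theorem B_comp (a b : A) : B ⬝ (a ⊚ b) = (B ⬝ a) ⊚ (B ⬝ b) := by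
  have h := congrArg (fun x => x ⬝ a ⬝ b) (ax_alpha (A := A) Sgn.pos)
  simp only [comp_app, ax_C] at h
  rw [ax_B, ax_B] at h
  exact h.symm

theorem comp_assoc (a b c : A) : (a ⊚ b) ⊚ c = a ⊚ b ⊚ c := by
  have h := congrArg (fun x => x ⬝ c) (B_comp a b)
  simp only [comp_app] at h
  exact h

theorem I_comp (a : A) : I ⊚ a = a := by
  simp [comp, ax_lambda, ax_I]

theorem B_I : (B : A) ⬝ I = I := ax_lambda

/-- `C b a = a• ∘ b`, and more generally `C (x ∘ z) y = (C x y) ∘ z`. -/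
theorem C_comp (s : Sgn) (x y z : A) : C s ⬝ (x ⊚ z) ⬝ y = (C s ⬝ x ⬝ y) ⊚ z := by
  have h := congrArg (fun t => t ⬝ x ⬝ y ⬝ z) (ax_bc (A := A) s)
  simp only [comp_app, ax_C] at h
  exact (show (C s ⬝ x ⬝ y) ⊚ z = C s ⬝ (x ⊚ z) ⬝ y by
    rw [ax_B, ax_B] at h
    exact h).symm

theorem dot_eq (s : Sgn) (a : A) : C s ⬝ I ⬝ a = dot a := C_eq _ _ _ _

theorem C_app (s : Sgn) (b a : A) : C s ⬝ b ⬝ a = dot a ⊚ b := by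
  have h := C_comp s I a b
  rwa [I_comp, dot_eq] at h

theorem dot_app (a b : A) : dot a ⬝ b = b ⬝ a := by
  simp [dot, ax_C, ax_I]

theorem dot_I_comp_B : dot (I : A) ⊚ B = I := by
  rw [← C_app Sgn.pos, ax_rho, B_I]

theorem comp_I (a : A) : a ⊚ I = a := by
  have h := congrArg (fun x => x ⬝ a) (dot_I_comp_B (A := A))
  simp only [comp_app, dot_app, ax_I] at h
  exact h

theorem C_comp_C (s : Sgn) : (C s : A) ⊚ C s.flip = I := by
  rw [ax_cox1, B_I, B_I]

theorem C_comp_C' (s : Sgn) : (C s.flip : A) ⊚ C s = I := by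
  cases s
  · exact C_comp_C Sgn.neg
  · exact C_comp_C Sgn.pos

theorem B_dot (s t : Sgn) (a : A) : B ⬝ dot a = C s ⬝ C t ⬝ a := by
  have h := congrArg (fun x => x ⬝ I ⬝ a) (ax_bc (A := A) t)
  simp only [comp_app] at h
  rw [B_I, show B ⬝ B ⬝ (C t ⬝ I) ⬝ a = B ⬝ (C t ⬝ I ⬝ a) from ax_B _ _ _] at h
  rw [← dot_eq t, h, C_eq s t]
  change C t ⬝ (B ⬝ C t ⬝ I) ⬝ a = _
  rw [show B ⬝ C t ⬝ I = C t from comp_I _]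

theorem dot_nat (s : Sgn) (a : A) : (B ⬝ dot a) ⊚ C s = dot a := by
  rw [B_dot s s.flip, ← C_comp, C_comp_C', dot_eq]

theorem dot_comp_C (s : Sgn) (a : A) : dot a ⊚ C s = B ⬝ dot a := by
  have h := dot_nat s.flip a
  conv_lhs => rw [← h, comp_assoc, C_comp_C', comp_I]

theorem BC_comp_BC (s : Sgn) : (B ⬝ (C s : A)) ⊚ (B ⬝ C s.flip) = I := by
  rw [← B_comp, C_comp_C, B_I]

theorem bc' (s : Sgn) : (B : A) ⊚ C s = (B ⬝ C s) ⊚ C s ⊚ (B ⬝ B) := by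
  have h := congrArg (fun x => (B ⬝ C s) ⊚ C s ⊚ x ⊚ C s) (ax_bc (A := A) s.flip)
  have e1 : (B ⬝ (C s : A)) ⊚ C s ⊚ ((B ⬝ B) ⊚ C s.flip) ⊚ C s
      = (B ⬝ C s) ⊚ C s ⊚ (B ⬝ B) := by
    rw [comp_assoc (B ⬝ B), C_comp_C', comp_I]
  have e2 : (B ⬝ (C s : A)) ⊚ C s ⊚ (C s.flip ⊚ ((B ⬝ C s.flip) ⊚ B)) ⊚ C s
      = B ⊚ C s := by
    simp only [← comp_assoc]
    rw [comp_assoc (B ⬝ C s), C_comp_C, comp_I, BC_comp_BC, I_comp]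
  rw [← e1, ← e2]
  exact h.symm

theorem dot_mul (a b : A) : dot (a ⬝ b) = dot b ⊚ dot a ⊚ B := by
  have h := congrArg (fun x => x ⬝ I ⬝ a ⬝ b) (bc' (A := A) Sgn.pos)
  simp only [comp_app] at h
  rw [show B ⬝ (C Sgn.pos ⬝ I) ⬝ a ⬝ b = dot (a ⬝ b) from ax_B _ _ _,
    show B ⬝ C Sgn.pos ⬝ (C Sgn.pos ⬝ (B ⬝ B ⬝ I)) ⬝ a
      = C Sgn.pos ⬝ (C Sgn.pos ⬝ (B ⬝ B ⬝ I) ⬝ a) from ax_B _ _ _,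
    show B ⬝ B ⬝ I = (B : A) from comp_I B, C_app, C_app] at h
  exact h

theorem comp_C (s : Sgn) (b x y : A) : b ⊚ (C s ⬝ x ⬝ y) = C s ⬝ ((B ⬝ b) ⊚ x) ⬝ y := by
  have h := congrArg (fun z => z ⬝ b ⬝ x ⬝ y) (ax_cox2 (A := A) s s)
  simp only [comp_app, ax_C] at h
  change B ⬝ (B ⬝ (B ⬝ b)) ⬝ C s ⬝ x ⬝ y = B ⬝ C s ⬝ (B ⬝ (B ⬝ b)) ⬝ x ⬝ y at h
  rw [ax_B, ax_B (C s)] at h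
  exact (ax_B _ _ _).symm.trans h

theorem comp_dot (b y : A) : b ⊚ dot y = dot y ⊚ (B ⬝ b) := by
  have h := comp_C Sgn.pos b I y
  rw [comp_I, C_app Sgn.pos (B ⬝ b)] at h
  exact h

/-! Arities -/

theorem cpow_succ (a : A) (n : ℕ) : cpow a (n + 1) = a ⊚ cpow a n := rfl

theorem cpow_add (a : A) (m n : ℕ) : cpow a (m + n) = cpow a m ⊚ cpow a n := by
  induction m with
  | zero => rw [Nat.zero_add]; exact (I_comp _).symm
  | succ k ih => rw [Nat.succ_add, cpow_succ, cpow_succ, ih, comp_assoc]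

theorem cpow_succ' (a : A) (n : ℕ) : cpow a (n + 1) = cpow a n ⊚ a := by
  rw [cpow_add]; congr 1; exact comp_I a

theorem cpow_app (n : ℕ) (b : A) : cpow B n ⬝ b = lwhisk n b := by
  induction n generalizing b with
  | zero => exact ax_I b
  | succ k ih => rw [cpow_succ', comp_app, ih]; rfl

theorem lwhisk_zero (b : A) : lwhisk 0 b = b := rfl

theorem lwhisk_succ (n : ℕ) (b : A) : lwhisk (n + 1) b = B ⬝ lwhisk n b :=
  Function.iterate_succ_apply' _ _ _

theorem lwhisk_one (b : A) : lwhisk 1 b = B ⬝ b := rfl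

theorem lwhisk_add (m n : ℕ) (b : A) : lwhisk (m + n) b = lwhisk m (lwhisk n b) :=
  Function.iterate_add_apply _ _ _ _

theorem lwhisk_comp (n : ℕ) (a b : A) : lwhisk n (a ⊚ b) = lwhisk n a ⊚ lwhisk n b := by
  induction n with
  | zero => rfl
  | succ k ih => rw [lwhisk_succ, ih, B_comp, lwhisk_succ, lwhisk_succ]

theorem lwhisk_I (n : ℕ) : lwhisk n (I : A) = I := by
  induction n with
  | zero => rfl
  | succ k ih => rw [lwhisk_succ, ih, B_I]

/-- Interchange. -/
theorem HasArity.nat {a : A} {m n : ℕ} (h : HasArity a m n) (b : A) :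
    lwhisk m b ⊚ a = a ⊚ lwhisk n b := by
  have h := congrArg (fun x => x ⬝ b) h
  simp only [comp_app, dot_app, cpow_app, lwhisk_succ] at h
  exact h

/-- Rewriting a product of two factors inside a right-associated composite. -/
theorem comp_assoc_of {a b c d : A} (h : a ⊚ b = c ⊚ d) (x : A) : a ⊚ b ⊚ x = c ⊚ d ⊚ x := by
  rw [← comp_assoc, h, comp_assoc]

theorem BB_comp_B (x : A) : B ⊚ (B ⬝ x) = (B ⬝ (B ⬝ x)) ⊚ B := by
  have h := congrArg (fun z => z ⬝ x) (ax_alpha (A := A) Sgn.pos)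
  simp only [comp_app] at h
  rw [C_app] at h
  simp only [comp_app, dot_app] at h
  exact h.symm

theorem cpow_B_comp (n : ℕ) (x : A) : cpow B n ⊚ (B ⬝ x) = (B ⬝ lwhisk n x) ⊚ cpow B n := by
  induction n with
  | zero => exact (I_comp _).trans (comp_I _).symm
  | succ k ih =>
    rw [cpow_succ, comp_assoc, ih, ← comp_assoc, BB_comp_B, comp_assoc, lwhisk_succ]

theorem HasArity.add {a : A} {m n : ℕ} (h : HasArity a m n) (k : ℕ) :
    HasArity a (m + k) (n + k) := by
  unfold HasArity at *
  rw [show m + k + 1 = (m + 1) + k by omega, cpow_add, ← comp_assoc, h, comp_assoc, ← cpow_add]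

theorem HasArity.B {a : A} {m n : ℕ} (h : HasArity a m n) :
    HasArity (B ⬝ a) (m + 1) (n + 1) := by
  have hB : dot (BCISignature.B : A) ⊚ cpow BCISignature.B 3
      = (BCISignature.B ⬝ BCISignature.B) ⊚ BCISignature.B := by
    have := ax_alpha (A := A) Sgn.pos
    rw [C_app, comp_assoc] at this
    simpa only [cpow, comp_I] using this
  unfold HasArity at *
  rw [dot_mul, comp_assoc, comp_assoc, ← cpow_succ,
    show m + 1 + 1 + 1 = 3 + m by omega, cpow_add, comp_assoc_of (c := _) (d := _) hB,
    ← comp_assoc, ← comp_dot, comp_assoc, ← cpow_succ, h, ← comp_assoc,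
    BB_comp_B, comp_assoc, ← cpow_succ]

theorem arity_I (n : ℕ) : HasArity (I : A) n n := by
  have h : HasArity (I : A) 0 0 := by
    unfold HasArity
    simp only [cpow, comp_I, dot_I_comp_B, B_I]
  simpa using h.add n

theorem arity_lwhisk {a : A} {m n : ℕ} (h : HasArity a m n) (l : ℕ) :
    HasArity (lwhisk l a) (l + m) (l + n) := by
  induction l with
  | zero => simpa [lwhisk_zero] using h
  | succ k ih =>
    rw [lwhisk_succ, show k + 1 + m = k + m + 1 by omega, show k + 1 + n = k + n + 1 by omega]
    exact ih.B

theorem HasArity.comp {a b : A} {l m n : ℕ} (ha : HasArity a l m) (hb : HasArity b m n) :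
    HasArity (a ⊚ b) l n := by
  have e : dot (a ⊚ b) = dot b ⊚ dot (BCISignature.B ⬝ a) ⊚ BCISignature.B := dot_mul _ _
  have h1 := ha.B
  unfold HasArity at *
  rw [e, comp_assoc, comp_assoc, ← cpow_succ, h1, ← comp_assoc, ← comp_dot, comp_assoc, hb,
    ← comp_assoc, ← B_comp]

theorem arity_B : HasArity (B : A) 2 1 := by
  have := ax_alpha (A := A) Sgn.pos
  rw [C_app, comp_assoc] at this
  simpa only [HasArity, cpow, comp_I] using this

theorem arity_C (s : Sgn) : HasArity (C s : A) 2 2 := by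
  have := ax_cox2 (A := A) s s
  rw [C_app, comp_assoc] at this
  simpa only [HasArity, cpow, comp_I] using this

theorem arity_dot (a : A) : HasArity (dot a) 0 1 := by
  have hC := arity_C (A := A) Sgn.pos
  have e : dot (dot a) ⊚ B = dot a ⊚ dot I ⊚ dot (C Sgn.pos) ⊚ cpow B 3 := by
    have e1 : dot (dot a) = dot a ⊚ dot (C Sgn.pos ⬝ I) ⊚ B := dot_mul _ _
    rw [e1, dot_mul]
    simp only [comp_assoc, cpow, comp_I]
  unfold HasArity at *
  simp only [cpow, comp_I] at *
  rw [e, hC, comp_assoc_of (comp_dot (C Sgn.pos) I).symm, ← comp_assoc (dot I), dot_I_comp_B,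
    I_comp, ← comp_assoc, dot_comp_C]

theorem arity_cpow_B (m : ℕ) : HasArity (cpow B m : A) (m + 1) 1 := by
  induction m with
  | zero => exact arity_I 1
  | succ k ih =>
    rw [cpow_succ]
    refine HasArity.comp (m := k + 1) ?_ ih
    have := (arity_B (A := A)).add k
    rwa [show 2 + k = k + 1 + 1 by omega, show 1 + k = k + 1 by omega] at this

/-- `(B h) ∘ Bⁿ` determines `h`. -/
theorem B_comp_cpow_inj {x y : A} {n : ℕ} (h : (B ⬝ x) ⊚ cpow B n = (B ⬝ y) ⊚ cpow B n) :
    x = y := by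
  have h := congrArg (fun z => z ⬝ I) h
  simp only [comp_app, cpow_app, lwhisk_I] at h
  exact (comp_I x).symm.trans (h.trans (comp_I y))

/-! The braid -/

theorem arity_braidOne (s : Sgn) (n : ℕ) : HasArity (braidOne s n : A) (n + 1) (n + 1) := by
  induction n with
  | zero => exact arity_I 1
  | succ k ih =>
    refine HasArity.comp (m := k + 1 + 1) ?_ ih.B
    rw [show k + 1 + 1 = 2 + k by omega]
    exact (arity_C s).add k

theorem arity_oneBraid (s : Sgn) (n : ℕ) : HasArity (oneBraid s n : A) (n + 1) (n + 1) := by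
  induction n with
  | zero => exact arity_I 1
  | succ k ih =>
    refine HasArity.comp (m := k + 1 + 1) ih.B ?_
    rw [show k + 1 + 1 = 2 + k by omega]
    exact (arity_C s).add k

theorem flip_flip (s : Sgn) : s.flip.flip = s := by cases s <;> rfl

theorem oneBraid_braidOne (s : Sgn) (n : ℕ) :
    (oneBraid s n : A) ⊚ braidOne s.flip n = I := by
  induction n with
  | zero => exact I_comp _
  | succ k ih =>
    rw [oneBraid, braidOne, comp_assoc, ← comp_assoc (C s), C_comp_C, I_comp, ← B_comp, ih, B_I]

theorem braidOne_oneBraid (s : Sgn) (n : ℕ) :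
    (braidOne s.flip n : A) ⊚ oneBraid s n = I := by
  induction n with
  | zero => exact I_comp _
  | succ k ih =>
    rw [oneBraid, braidOne, comp_assoc, ← comp_assoc (B ⬝ braidOne _ _), ← B_comp, ih, B_I,
      I_comp, C_comp_C']

theorem braidOne_add (s : Sgn) (m n : ℕ) :
    (braidOne s (m + n) : A) = braidOne s m ⊚ lwhisk m (braidOne s n) := by
  induction m with
  | zero => rw [Nat.zero_add]; exact (I_comp _).symm
  | succ k ih =>
    rw [show k + 1 + n = (k + n) + 1 by omega, braidOne, braidOne, ih, B_comp, comp_assoc,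
      lwhisk_succ]

/-- Naturality of `σ_{1,n}` at `f : m → n`. -/
def BraidNat (s : Sgn) (f : A) (m n : ℕ) : Prop :=
  (B ⬝ f) ⊚ braidOne s n = braidOne s m ⊚ f

theorem BraidNat.add {s : Sgn} {f : A} {m n : ℕ} (h : BraidNat s f m n) (hf : HasArity f m n)
    (k : ℕ) : BraidNat s f (m + k) (n + k) := by
  unfold BraidNat at *
  rw [braidOne_add, braidOne_add, ← comp_assoc, h, comp_assoc, comp_assoc, hf.nat]

theorem BraidNat.B {s : Sgn} {f : A} {m n : ℕ} (h : BraidNat s f m n) :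
    BraidNat s (B ⬝ f) (m + 1) (n + 1) := by
  have hC := (arity_C (A := A) s).nat f
  simp only [lwhisk_succ, lwhisk_zero] at hC
  unfold BraidNat at *
  rw [braidOne, braidOne, ← comp_assoc, hC, comp_assoc, ← B_comp, h, B_comp, comp_assoc]

theorem BraidNat.comp {s : Sgn} {f g : A} {l m n : ℕ} (hf : BraidNat s f l m)
    (hg : BraidNat s g m n) : BraidNat s (f ⊚ g) l n := by
  unfold BraidNat at *
  rw [B_comp, comp_assoc, hg, ← comp_assoc, hf, comp_assoc]

theorem braidNat_B (s : Sgn) : BraidNat s (B : A) 2 1 := by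
  have := ax_bc (A := A) s
  simpa only [BraidNat, braidOne, B_I, comp_I, comp_assoc] using this

theorem braidNat_dot (s : Sgn) (a : A) : BraidNat s (dot a) 0 1 := by
  simp only [BraidNat, braidOne, B_I, comp_I, I_comp, dot_nat]

theorem braidNat_cpow (s : Sgn) (m : ℕ) : BraidNat s (cpow B m : A) (m + 1) 1 := by
  induction m with
  | zero => simp only [BraidNat, braidOne, cpow, B_I, comp_I, I_comp]
  | succ k ih =>
    rw [cpow_succ]
    refine BraidNat.comp (m := k + 1) ?_ ih
    have := (braidNat_B (A := A) s).add arity_B k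
    rwa [show 2 + k = k + 1 + 1 by omega, show 1 + k = k + 1 by omega] at this

theorem braidNat {f : A} {m n : ℕ} (h : HasArity f m n) (s : Sgn) : BraidNat s f m n := by
  have h1 : BraidNat s (dot f ⊚ cpow B (m + 1)) (m + 1) 1 := by
    refine BraidNat.comp (m := m + 1 + 1) ?_ (braidNat_cpow s (m + 1))
    have := (braidNat_dot s f).add (arity_dot f) (m + 1)
    rwa [show 0 + (m + 1) = m + 1 by omega, show 1 + (m + 1) = m + 1 + 1 by omega] at this
  rw [show dot f ⊚ cpow B (m + 1) = (BCISignature.B ⬝ f) ⊚ cpow BCISignature.B n from h] at h1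
  have h2 := braidNat_cpow (A := A) s n
  have hC := (arity_C (A := A) s).nat f
  simp only [lwhisk_succ, lwhisk_zero] at hC
  unfold BraidNat at h1 h2
  rw [B_comp, comp_assoc, h2, braidOne, comp_assoc, ← comp_assoc, hC, braidOne] at h1
  have h3 := congrArg (fun z => C s.flip ⊚ z) h1
  simp only [← comp_assoc, C_comp_C', I_comp] at h3
  simp only [← B_comp] at h3
  exact B_comp_cpow_inj h3

/-- Naturality of `σ_{m,1}` at `f : m → n`. -/
theorem oneBraid_nat {f : A} {m n : ℕ} (h : HasArity f m n) (s : Sgn) :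
    f ⊚ oneBraid s n = oneBraid s m ⊚ (B ⬝ f) := by
  have h1 : (B ⬝ f) ⊚ braidOne s.flip n = braidOne s.flip m ⊚ f := braidNat h s.flip
  calc f ⊚ oneBraid s n
      = oneBraid s m ⊚ (braidOne s.flip m ⊚ f) ⊚ oneBraid s n := by
        rw [comp_assoc, ← comp_assoc (oneBraid s m), oneBraid_braidOne, I_comp]
    _ = oneBraid s m ⊚ (B ⬝ f) := by
        rw [← h1, comp_assoc, braidOne_oneBraid, comp_I]

theorem arity_braid (m n : ℕ) : HasArity (braid m n : A) (m + n) (n + m) := by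
  induction n with
  | zero => rw [Nat.add_comm]; exact arity_I _
  | succ k ih =>
    refine HasArity.comp (m := m + k + 1) ?_ ?_
    · have := (arity_oneBraid (A := A) Sgn.pos m).add k
      rwa [show m + 1 + k = m + k + 1 by omega] at this
    · rw [show k + 1 + m = k + m + 1 by omega]
      exact ih.B

theorem arity_braidInv (m n : ℕ) : HasArity (braidInv m n : A) (n + m) (m + n) := by
  induction n with
  | zero => rw [Nat.add_comm]; exact arity_I _
  | succ k ih =>
    refine HasArity.comp (m := m + k + 1) ?_ ?_
    · rw [show k + 1 + m = k + m + 1 by omega]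
      exact ih.B
    · have := (arity_braidOne (A := A) Sgn.neg m).add k
      rwa [show m + 1 + k = m + k + 1 by omega] at this

theorem braid_braidInv (m n : ℕ) : (braid m n : A) ⊚ braidInv m n = I := by
  induction n with
  | zero => exact I_comp _
  | succ k ih =>
    rw [braid, braidInv, comp_assoc, ← comp_assoc (B ⬝ braid _ _), ← B_comp, ih, B_I, I_comp]
    exact oneBraid_braidOne Sgn.pos m

theorem braidInv_braid (m n : ℕ) : (braidInv m n : A) ⊚ braid m n = I := by
  induction n with
  | zero => exact I_comp _
  | succ k ih =>
    have e : (braidOne Sgn.neg m : A) ⊚ oneBraid Sgn.pos m = I := braidOne_oneBraid Sgn.pos m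
    rw [braid, braidInv, comp_assoc, ← comp_assoc (braidOne _ _), e, I_comp, ← B_comp, ih, B_I]

theorem braid_one (m : ℕ) : (braid m 1 : A) = oneBraid Sgn.pos m := by
  rw [braid, braid, B_I, comp_I]

theorem one_braid (n : ℕ) : (braid 1 n : A) = braidOne Sgn.pos n := by
  induction n with
  | zero => rfl
  | succ k ih => rw [braid, braidOne, ih, oneBraid, oneBraid, B_I, I_comp]

theorem zero_braid (n : ℕ) : (braid 0 n : A) = I := by
  induction n with
  | zero => rfl
  | succ k ih => rw [braid, ih, oneBraid, B_I, I_comp]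

/-- First hexagon. -/
theorem braid_add_right (l m n : ℕ) :
    (braid l (m + n) : A) = braid l m ⊚ lwhisk m (braid l n) := by
  induction m with
  | zero => rw [Nat.zero_add]; exact (I_comp _).symm
  | succ k ih =>
    rw [show k + 1 + n = (k + n) + 1 by omega, braid, braid, ih, B_comp, comp_assoc, lwhisk_succ]

theorem oneBraid_add (l m : ℕ) :
    (oneBraid Sgn.pos (l + m) : A)
      = lwhisk l (oneBraid Sgn.pos m) ⊚ oneBraid Sgn.pos l := by
  induction l with
  | zero => rw [Nat.zero_add]; exact (comp_I _).symm
  | succ k ih =>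
    rw [show k + 1 + m = (k + m) + 1 by omega, oneBraid, oneBraid, ih, B_comp, comp_assoc,
      lwhisk_succ]

/-- Second hexagon. -/
theorem braid_add_left (l m n : ℕ) :
    (braid (l + m) n : A) = lwhisk l (braid m n) ⊚ braid l n := by
  induction n with
  | zero => simp only [braid, lwhisk_I, I_comp]
  | succ k ih =>
    have h := (arity_oneBraid (A := A) Sgn.pos l).nat (braid m k)
    have e : lwhisk l (B ⬝ braid m k : A) = lwhisk (l + 1) (braid m k) := (lwhisk_add l 1 _).symm
    rw [braid, braid, braid, oneBraid_add, ih, B_comp, lwhisk_comp, comp_assoc, comp_assoc, e,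
      ← lwhisk_succ, comp_assoc_of h]

theorem braid_nat_right {f : A} {m n : ℕ} (h : HasArity f m n) (l : ℕ) :
    lwhisk l f ⊚ braid l n = braid l m ⊚ f := by
  induction l with
  | zero => simp only [zero_braid, lwhisk_zero, comp_I, I_comp]
  | succ k ih =>
    have h1 : (B ⬝ f) ⊚ braidOne Sgn.pos n = braidOne Sgn.pos m ⊚ f := braidNat h Sgn.pos
    rw [braid_add_left, braid_add_left, lwhisk_add, lwhisk_one, one_braid, one_braid,
      ← comp_assoc, ← lwhisk_comp, h1, lwhisk_comp, comp_assoc, ih, comp_assoc]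

theorem braid_nat_left {f : A} {m n : ℕ} (h : HasArity f m n) (l : ℕ) :
    f ⊚ braid n l = braid m l ⊚ lwhisk l f := by
  induction l with
  | zero => exact (comp_I _).trans (I_comp _).symm
  | succ k ih =>
    rw [braid, braid, ← comp_assoc, oneBraid_nat h, comp_assoc, ← B_comp, ih, B_comp,
      comp_assoc, lwhisk_succ]

end Lemmas

section TwistLemmas
variable {A : Type u} [BalancedExtBCIAlgebra A]
open BalancedExtBCIAlgebra

theorem θ_comp_θ (s : Sgn) : (θ s : A) ⊚ θ s.flip = I := by
  rw [ax_θ2, B_I]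

theorem arity_θ (s : Sgn) : HasArity (θ s : A) 1 1 := by
  have h := ax_θ1 (A := A) s Sgn.pos
  rw [C_app, comp_assoc] at h
  simpa only [HasArity, cpow, comp_I] using h.symm

theorem dot_comp_θ (s : Sgn) (a : A) : dot a ⊚ θ s = dot a := by
  rw [← C_app Sgn.pos, ax_θ3 Sgn.pos s Sgn.pos, dot]

theorem arity_twist (m : ℕ) : HasArity (twist m : A) m m := by
  induction m with
  | zero => exact arity_I 0
  | succ k ih =>
    have h1 : HasArity (θ Sgn.pos : A) (k + 1) (k + 1) := by
      simpa only [Nat.add_comm] using (arity_θ (A := A) Sgn.pos).add k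
    have h2 : HasArity (braid 1 k : A) (k + 1) (k + 1) := by
      simpa only [Nat.add_comm] using arity_braid (A := A) 1 k
    have h3 : HasArity (braid k 1 : A) (k + 1) (k + 1) := by
      simpa only [Nat.add_comm] using arity_braid (A := A) k 1
    exact h1.comp (h2.comp ((ih.add 1).comp h3))

theorem arity_twistInv (m : ℕ) : HasArity (twistInv m : A) m m := by
  induction m with
  | zero => exact arity_I 0
  | succ k ih =>
    have h1 : HasArity (θ Sgn.neg : A) (k + 1) (k + 1) := by
      simpa only [Nat.add_comm] using (arity_θ (A := A) Sgn.neg).add k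
    have h2 : HasArity (braidInv 1 k : A) (k + 1) (k + 1) := by
      simpa only [Nat.add_comm] using arity_braidInv (A := A) 1 k
    have h3 : HasArity (braidInv k 1 : A) (k + 1) (k + 1) := by
      simpa only [Nat.add_comm] using arity_braidInv (A := A) k 1
    exact h3.comp ((ih.add 1).comp (h2.comp h1))

theorem cancel_mid {a b c d : A} (h : b ⊚ c = I) : a ⊚ b ⊚ c ⊚ d = a ⊚ d := by
  rw [← comp_assoc b, h, I_comp]

theorem twist_twistInv (m : ℕ) : (twist m : A) ⊚ twistInv m = I := by
  induction m with
  | zero => exact I_comp _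
  | succ k ih =>
    simp only [twist, twistInv, comp_assoc]
    rw [cancel_mid (braid_braidInv k 1), cancel_mid ih, cancel_mid (braid_braidInv 1 k)]
    exact θ_comp_θ Sgn.pos

theorem twistInv_twist (m : ℕ) : (twistInv m : A) ⊚ twist m = I := by
  induction m with
  | zero => exact I_comp _
  | succ k ih =>
    simp only [twist, twistInv, comp_assoc]
    have hn : (θ Sgn.neg : A) ⊚ θ Sgn.pos = I := θ_comp_θ Sgn.neg
    rw [cancel_mid hn, cancel_mid (braidInv_braid 1 k), cancel_mid ih]
    exact braidInv_braid k 1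

theorem twist_add (m n : ℕ) :
    (twist (m + n) : A) = twist m ⊚ braid m n ⊚ twist n ⊚ braid n m := by
  induction m with
  | zero => rw [Nat.zero_add, zero_braid, braid, comp_I, I_comp]; exact (I_comp _).symm
  | succ k ih =>
    have e1 := (arity_twist (A := A) k).nat (braid 1 n)
    have e2 : lwhisk k (braid 1 n : A) ⊚ braid k n = braid (k + 1) n :=
      (braid_add_left k 1 n).symm
    have e3 : (braid n k : A) ⊚ lwhisk k (braid n 1) = braid n (k + 1) :=
      (braid_add_right n k 1).symm
    have e4 := braid_nat_right (arity_braid (A := A) k 1) n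
    have e5 := (arity_twist (A := A) n).nat (braid k 1)
    have e6 := braid_nat_left (arity_braid (A := A) k 1) n
    rw [Nat.add_comm 1 k] at e4 e6
    rw [show k + 1 + n = (k + n) + 1 by omega, twist, twist, ih, braid_add_right 1 k n,
      braid_add_left k n 1]
    simp only [comp_assoc]
    rw [comp_assoc_of e1, ← comp_assoc (lwhisk k (braid 1 n)), e2,
      ← comp_assoc (braid n k), e3, ← e4, comp_assoc_of e5.symm, comp_assoc_of e6.symm]

/-- Naturality of the twist at `f : m → n`. -/
def TwistNat (f : A) (m n : ℕ) : Prop := f ⊚ twist n = twist m ⊚ f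

theorem TwistNat.comp {f g : A} {l m n : ℕ} (hf : TwistNat f l m) (hg : TwistNat g m n) :
    TwistNat (f ⊚ g) l n := by
  unfold TwistNat at *
  rw [comp_assoc, hg, ← comp_assoc, hf, comp_assoc]

theorem TwistNat.add {f : A} {m n : ℕ} (h : TwistNat f m n) (hf : HasArity f m n) (k : ℕ) :
    TwistNat f (m + k) (n + k) := by
  have e1 := braid_nat_left hf k
  have e2 := (arity_twist (A := A) k).nat f
  have e3 := braid_nat_right hf k
  unfold TwistNat at *
  rw [twist_add, twist_add, comp_assoc_of h, comp_assoc_of e1, comp_assoc_of e2, e3]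
  simp only [comp_assoc]

theorem twist_one : (twist 1 : A) = θ Sgn.pos := by
  simp only [twist, braid, oneBraid, B_I, comp_I]

theorem twistNat_B : TwistNat (B : A) 2 1 := by
  have h := ax_θ4 (A := A) Sgn.pos
  have e : (braid 1 1 : A) = C Sgn.pos := by
    rw [braid_one, oneBraid, oneBraid, B_I, I_comp]
  have e2 : (twist 2 : A) = θ Sgn.pos ⊚ C Sgn.pos ⊚ θ Sgn.pos ⊚ C Sgn.pos := by
    rw [← e, ← twist_one]
    exact twist_add 1 1
  unfold TwistNat
  rw [twist_one, h, e2]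
  simp only [comp_assoc]

theorem twistNat_dot (a : A) : TwistNat (dot a) 0 1 := by
  unfold TwistNat
  rw [twist_one, dot_comp_θ]
  exact (I_comp _).symm

theorem twistNat_cpow (m : ℕ) : TwistNat (cpow B m : A) (m + 1) 1 := by
  induction m with
  | zero => exact (I_comp _).trans (comp_I _).symm
  | succ k ih =>
    rw [cpow_succ]
    refine TwistNat.comp (m := k + 1) ?_ ih
    have := (twistNat_B (A := A)).add arity_B k
    rwa [show 2 + k = k + 1 + 1 by omega, show 1 + k = k + 1 by omega] at this

theorem twistNat {f : A} {m n : ℕ} (h : HasArity f m n) : TwistNat f m n := by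
  have h1 : TwistNat (dot f ⊚ cpow B (m + 1)) (m + 1) 1 := by
    refine TwistNat.comp (m := m + 1 + 1) ?_ (twistNat_cpow (m + 1))
    have := (twistNat_dot f).add (arity_dot f) (m + 1)
    rwa [show 0 + (m + 1) = m + 1 by omega, show 1 + (m + 1) = m + 1 + 1 by omega] at this
  rw [show dot f ⊚ cpow B (m + 1) = (B ⬝ f) ⊚ cpow B n from h] at h1
  have h2 := twistNat_cpow (A := A) n
  have hθ := (arity_θ (A := A) Sgn.pos).nat f
  have hb := braid_nat_right h 1
  have hb1 := braid_nat_left h 1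
  have hc1 := braid_nat_left (h.comp (arity_twist n)) 1
  have hc2 := braid_nat_left ((arity_twist m).comp h) 1
  simp only [lwhisk_one] at hθ hb hb1 hc1 hc2
  unfold TwistNat at h1 h2
  rw [comp_assoc, h2] at h1
  simp only [twist, comp_assoc] at h1
  rw [comp_assoc_of hθ, comp_assoc_of hb] at h1
  have h3 := congrArg (fun z => braidInv 1 m ⊚ θ Sgn.neg ⊚ z) h1
  have hn : (θ Sgn.neg : A) ⊚ θ Sgn.pos = I := θ_comp_θ Sgn.neg
  rw [cancel_mid hn, cancel_mid hn, ← comp_assoc (braidInv 1 m), ← comp_assoc (braidInv 1 m),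
    braidInv_braid, I_comp, I_comp] at h3
  rw [← comp_assoc_of hb1] at h3
  simp only [← comp_assoc] at h3
  rw [hc1, hc2] at h3
  have h4 := congrArg (fun z => braidInv m 1 ⊚ z) h3
  simp only [comp_assoc] at h4
  rw [← comp_assoc (braidInv m 1), ← comp_assoc (braidInv m 1), braidInv_braid, I_comp,
    I_comp] at h4
  exact B_comp_cpow_inj h4

end TwistLemmas

end BCI

/-- The objects of the internal PROB: natural numbers, tagged by the algebra. -/
structure InternalPROB (A : Type u) : Type where
  arity : ℕ

namespace InternalPROB
open BCI BCISignature

section Braided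
variable {A : Type u} [ExtBCIAlgebra A]

/-- Morphisms `m ⟶ n` are the elements of arity `m → n`; the composite of `a` and `b` is `a ∘ b`,
and the identities are `I`. -/
instance category : Category.{u} (InternalPROB A) where
  Hom m n := {a : A // HasArity a m.arity n.arity}
  id m := ⟨I, arity_I m.arity⟩
  comp f g := ⟨f.1 ⊚ g.1, f.2.comp g.2⟩
  id_comp f := Subtype.ext (I_comp f.1)
  comp_id f := Subtype.ext (comp_I f.1)
  assoc f g h := Subtype.ext (comp_assoc f.1 g.1 h.1)

theorem hom_ext {X Y : InternalPROB A} {f g : X ⟶ Y} (h : f.1 = g.1) : f = g := Subtype.ext h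

/-- The structural isomorphism between equal objects; its underlying element is `I`. -/
def strictIso {X Y : InternalPROB A} (h : X.arity = Y.arity) : X ≅ Y where
  hom := ⟨I, h ▸ arity_I X.arity⟩
  inv := ⟨I, h ▸ arity_I X.arity⟩
  hom_inv_id := hom_ext (I_comp I)
  inv_hom_id := hom_ext (I_comp I)

/-- On objects the tensor is addition, `l + a = Bˡ a` and `a + l = a`; the monoidal structure is
strict, in that all associators and unitors are `I`. -/
instance monoidal : MonoidalCategory (InternalPROB A) where
  tensorObj m n := ⟨m.arity + n.arity⟩
  tensorUnit := ⟨0⟩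
  whiskerLeft l _ _ f := ⟨lwhisk l.arity f.1, arity_lwhisk f.2 l.arity⟩
  whiskerRight f l := ⟨f.1, f.2.add l.arity⟩
  tensorHom {_ n m' _} f g :=
    ⟨f.1 ⊚ lwhisk n.arity g.1, (f.2.add m'.arity).comp (arity_lwhisk g.2 n.arity)⟩
  associator l m n := strictIso (Nat.add_assoc l.arity m.arity n.arity)
  leftUnitor m := strictIso (Nat.zero_add m.arity)
  rightUnitor m := strictIso (Nat.add_zero m.arity)
  tensorHom_def _ _ := rfl
  id_tensorHom_id l _ := hom_ext ((I_comp _).trans (lwhisk_I l.arity))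
  tensorHom_comp_tensorHom f₁ f₂ g₁ g₂ := hom_ext <| by
    change (f₁.1 ⊚ lwhisk _ f₂.1) ⊚ g₁.1 ⊚ lwhisk _ g₂.1
      = (f₁.1 ⊚ g₁.1) ⊚ lwhisk _ (f₂.1 ⊚ g₂.1)
    rw [comp_assoc, ← comp_assoc (lwhisk _ f₂.1), g₁.2.nat, lwhisk_comp]
    simp only [comp_assoc]
  whiskerLeft_id l _ := hom_ext (lwhisk_I l.arity)
  id_whiskerRight _ _ := rfl
  associator_naturality {_ _ _ n₁ n₂ _} f₁ f₂ f₃ := hom_ext <| by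
    change ((f₁.1 ⊚ lwhisk _ f₂.1) ⊚ lwhisk (n₁.arity + n₂.arity) f₃.1) ⊚ I
      = I ⊚ f₁.1 ⊚ lwhisk n₁.arity (f₂.1 ⊚ lwhisk n₂.arity f₃.1)
    rw [comp_I, I_comp, lwhisk_comp, lwhisk_add, comp_assoc]
  leftUnitor_naturality f := hom_ext ((comp_I f.1).trans (I_comp f.1).symm)
  rightUnitor_naturality f := hom_ext ((comp_I f.1).trans (I_comp f.1).symm)
  pentagon l _ _ _ := hom_ext <| by
    change I ⊚ I ⊚ lwhisk l.arity I = I ⊚ I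
    rw [lwhisk_I, I_comp]
  triangle l _ := hom_ext <| by
    change I ⊚ lwhisk l.arity I = I
    rw [lwhisk_I, I_comp]

/-- The braid is `σ_{m,n}`. -/
instance braided : BraidedCategory (InternalPROB A) where
  braiding m n :=
    { hom := ⟨braid m.arity n.arity, arity_braid _ _⟩
      inv := ⟨braidInv m.arity n.arity, arity_braidInv _ _⟩
      hom_inv_id := hom_ext (braid_braidInv _ _)
      inv_hom_id := hom_ext (braidInv_braid _ _) }
  braiding_naturality_right l _ _ f := hom_ext (braid_nat_right f.2 l.arity)
  braiding_naturality_left f l := hom_ext (braid_nat_left f.2 l.arity)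
  hexagon_forward l m n := hom_ext <| by
    change I ⊚ braid l.arity (m.arity + n.arity) ⊚ I
      = braid l.arity m.arity ⊚ I ⊚ lwhisk m.arity (braid l.arity n.arity)
    rw [I_comp, comp_I, I_comp, braid_add_right]
  hexagon_reverse l m n := hom_ext <| by
    change I ⊚ braid (l.arity + m.arity) n.arity ⊚ I
      = lwhisk l.arity (braid m.arity n.arity) ⊚ I ⊚ braid l.arity n.arity
    rw [I_comp, comp_I, I_comp, braid_add_left]

end Braided
end InternalPROB

/-- A balanced monoidal category: a braided monoidal category with a twist. -/
class BalancedMonoidalCategory (𝒞 : Type v) [Category.{w} 𝒞] [MonoidalCategory 𝒞]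
    [BraidedCategory 𝒞] where
  twist : ∀ X : 𝒞, X ≅ X
  twist_naturality : ∀ {X Y : 𝒞} (f : X ⟶ Y), f ≫ (twist Y).hom = (twist X).hom ≫ f
  twist_tensor : ∀ X Y : 𝒞, (twist (X ⊗ Y)).hom
    = (β_ X Y).hom ≫ ((twist Y).hom ⊗ₘ (twist X).hom) ≫ (β_ Y X).hom

namespace InternalPROB
open BCI BCISignature

/-- The twist is `θ_m`. -/
instance balanced {A : Type u} [BalancedExtBCIAlgebra A] :
    BalancedMonoidalCategory (InternalPROB A) where
  twist m :=
    { hom := ⟨BCI.twist m.arity, arity_twist _⟩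
      inv := ⟨BCI.twistInv m.arity, arity_twistInv _⟩
      hom_inv_id := hom_ext (twist_twistInv _)
      inv_hom_id := hom_ext (twistInv_twist _) }
  twist_naturality f := hom_ext (twistNat f.2)
  twist_tensor m n := hom_ext <| by
    change BCI.twist (m.arity + n.arity) = braid m.arity n.arity ⊚
      (BCI.twist n.arity ⊚ lwhisk n.arity (BCI.twist m.arity)) ⊚ braid n.arity m.arity
    have e1 := (arity_twist (A := A) n.arity).nat (BCI.twist m.arity)
    have e2 := braid_nat_left (arity_twist (A := A) m.arity) n.arity
    rw [twist_add, comp_assoc_of e2, ← comp_assoc (lwhisk _ _), e1]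

end InternalPROB

/-- A (right) trace on a balanced monoidal category. -/
structure MonoidalTrace (𝒞 : Type v) [Category.{w} 𝒞] [MonoidalCategory 𝒞] [BraidedCategory 𝒞]
    [BalancedMonoidalCategory 𝒞] where
  tr : ∀ (X : 𝒞) {A B : 𝒞}, (A ⊗ X ⟶ B ⊗ X) → (A ⟶ B)
  tightening : ∀ (X : 𝒞) {A A' B B' : 𝒞} (g : A' ⟶ A) (f : A ⊗ X ⟶ B ⊗ X) (h : B ⟶ B'),
    tr X (g ▷ X ≫ f ≫ h ▷ X) = g ≫ tr X f ≫ h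
  sliding : ∀ {X Y A B : 𝒞} (f : A ⊗ X ⟶ B ⊗ Y) (h : Y ⟶ X),
    tr X (f ≫ B ◁ h) = tr Y (A ◁ h ≫ f)
  vanishing_unit : ∀ {A B : 𝒞} (f : A ⊗ 𝟙_ 𝒞 ⟶ B ⊗ 𝟙_ 𝒞),
    tr (𝟙_ 𝒞) f = (ρ_ A).inv ≫ f ≫ (ρ_ B).hom
  vanishing_tensor : ∀ (X Y : 𝒞) {A B : 𝒞} (f : A ⊗ (X ⊗ Y) ⟶ B ⊗ (X ⊗ Y)),
    tr (X ⊗ Y) f = tr X (tr Y ((α_ A X Y).hom ≫ f ≫ (α_ B X Y).inv))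
  superposing : ∀ (X Z : 𝒞) {A B : 𝒞} (f : A ⊗ X ⟶ B ⊗ X),
    tr X ((α_ Z A X).hom ≫ Z ◁ f ≫ (α_ Z B X).inv) = Z ◁ tr X f
  yanking : ∀ X : 𝒞, tr X (β_ X X).hom = (BalancedMonoidalCategory.twist X).hom
  yanking_inv : ∀ X : 𝒞, tr X (β_ X X).inv = (BalancedMonoidalCategory.twist X).inv

/-- The left trace associated with a (right) trace:
`Tr_L^X(f) = Tr^X(σ_{X,A}⁻¹ ; f ; σ_{X,B})`. -/
def MonoidalTrace.leftTr {𝒞 : Type v} [Category.{w} 𝒞] [MonoidalCategory 𝒞] [BraidedCategory 𝒞]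
    [BalancedMonoidalCategory 𝒞] (T : MonoidalTrace 𝒞) (X : 𝒞) {A B : 𝒞}
    (f : X ⊗ A ⟶ X ⊗ B) : A ⟶ B :=
  T.tr X ((β_ X A).inv ≫ f ≫ (β_ X B).hom)

/-! The work is done with the left trace, that is, with iterated application of `Tr`; the right
trace is then defined by conjugating with the braid, so that its associated left trace is iterated
`Tr` again by cancellation of braids.

The two tightening axioms become naturality of `Tr` in both arguments (`Tr_comp_left`,
`Tr_comp_right`) and the stability of arities (`HasArity.Tr`). Exchange says that two traced strands
may be conjugated by the generating braid; building up `σ_{m,n}` from generators gives invariance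
under every block braid (`trInvariant_braid`). Yanking on one strand extends to `n` strands by the
hexagons (`iterTr_braid`).

Sliding is not an axiom and is the crux. A composite of `f`, `h` and a self-braid is traced over `n
+ m` strands in two ways, related by conjugation with `σ_{n,m}`; yanking turns each self-braid into
a twist, and naturality of the twist removes it (`iterTr_slide`). Vanishing again rests on block
braid invariance, and superposing on naturality of the braid. -/

namespace BCI

open BCISignature ExtBCIAlgebra BalancedExtBCIAlgebra TracedExtBCIAlgebra

/-! ### Hexagons and naturality for the inverse braid -/

section BraidInverse
variable {A : Type u} [ExtBCIAlgebra A]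

theorem inverse_unique {x y z : A} (hl : y ⊚ x = I) (hr : x ⊚ z = I) : y = z := by
  rw [← comp_I y, ← hr, ← comp_assoc, hl, I_comp]

theorem lwhisk_inverse {x y : A} (h : x ⊚ y = I) (n : ℕ) : lwhisk n x ⊚ lwhisk n y = I := by
  rw [← lwhisk_comp, h, lwhisk_I]

theorem comp_inverse {x x' y y' : A} (hx : x ⊚ x' = I) (hy : y ⊚ y' = I) :
    (x ⊚ y) ⊚ y' ⊚ x' = I := by
  rw [comp_assoc, ← comp_assoc y, hy, I_comp, hx]

/-- Uniqueness of inverses transfers the hexagon for `braid`, so no second induction is needed. -/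
theorem braidInv_add_right (l m n : ℕ) :
    (braidInv l (m + n) : A) = lwhisk m (braidInv l n) ⊚ braidInv l m := by
  refine inverse_unique (braidInv_braid l (m + n)) ?_
  rw [braid_add_right]
  exact comp_inverse (braid_braidInv l m) (lwhisk_inverse (braid_braidInv l n) m)

theorem braidInv_add_left (l m n : ℕ) :
    (braidInv (l + m) n : A) = braidInv l n ⊚ lwhisk l (braidInv m n) := by
  refine inverse_unique (braidInv_braid (l + m) n) ?_
  rw [braid_add_left]
  exact comp_inverse (lwhisk_inverse (braid_braidInv m n) l) (braid_braidInv l n)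

theorem braidInv_nat_right {f : A} {m n : ℕ} (h : HasArity f m n) (l : ℕ) :
    braidInv l m ⊚ lwhisk l f = f ⊚ braidInv l n := by
  rw [← comp_I (braidInv l m ⊚ lwhisk l f), ← braid_braidInv l n, comp_assoc,
    comp_assoc_of (braid_nat_right h l), ← comp_assoc, braidInv_braid, I_comp]

theorem braidInv_nat_left {f : A} {m n : ℕ} (h : HasArity f m n) (l : ℕ) :
    braidInv m l ⊚ f = lwhisk l f ⊚ braidInv n l := by
  rw [← comp_I (braidInv m l ⊚ f), ← braid_braidInv n l, comp_assoc,
    comp_assoc_of (braid_nat_left h l), ← comp_assoc, braidInv_braid, I_comp]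

/-- Whiskering on the left is conjugation by the braid. -/
theorem lwhisk_eq_conj {f : A} {m n : ℕ} (h : HasArity f m n) (l : ℕ) :
    lwhisk l f = braidInv m l ⊚ f ⊚ braid n l := by
  rw [braid_nat_left h, ← comp_assoc, braidInv_braid, I_comp]

end BraidInverse

/-! ### Tightening and arities for iterated `Tr` -/

section Trace
variable {A : Type u} [TracedExtBCIAlgebra A]

/-- The left trace on `k` strands: apply `Tr` to `f` exactly `k` times. -/
def iterTr (k : ℕ) (f : A) : A := (fun a : A => Tr ⬝ a)^[k] f

theorem iterTr_zero (f : A) : iterTr 0 f = f := rfl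

theorem iterTr_add (k l : ℕ) (f : A) : iterTr (k + l) f = iterTr k (iterTr l f) :=
  Function.iterate_add_apply _ _ _ _

theorem iterTr_add' (k l : ℕ) (f : A) : iterTr (k + l) f = iterTr l (iterTr k f) := by
  rw [Nat.add_comm, iterTr_add]

theorem iterTr_one (f : A) : iterTr 1 f = Tr ⬝ f := rfl

theorem iterTr_succ (k : ℕ) (f : A) : iterTr (k + 1) f = iterTr k (Tr ⬝ f) := rfl

theorem iterTr_succ' (k : ℕ) (f : A) : iterTr (k + 1) f = Tr ⬝ iterTr k f :=
  Function.iterate_succ_apply' _ _ _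

/-- Left tightening is literally an arity statement about the combinator `Tr`, so the general
interchange law applies to it. -/
theorem arity_Tr : HasArity (Tr : A) 1 2 := by
  have h := left_tightening (A := A) Sgn.pos
  rw [C_app, comp_assoc] at h
  simpa only [HasArity, cpow, comp_I] using h

/-- Interchange of `Tr` with `x`, evaluated at `y`. No arity is required of `x` or `y`. -/
theorem Tr_comp_left (x y : A) : Tr ⬝ ((B ⬝ x) ⊚ y) = x ⊚ (Tr ⬝ y) := by
  have h := congrArg (fun z => z ⬝ y) ((arity_Tr (A := A)).nat x)
  simp only [comp_app, lwhisk_succ, lwhisk_zero] at h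
  exact h.symm

theorem B_Tr (x : A) : B ⬝ (Tr ⬝ x) = Tr ⊚ (B ⬝ x) ⊚ B := by
  have h := congrArg (fun z => z ⬝ x) (right_tightening (A := A) Sgn.pos)
  simp only [comp_app, ax_C] at h
  exact h.symm

theorem Tr_comp_right (x y : A) : Tr ⬝ (x ⊚ (B ⬝ y)) = (Tr ⬝ x) ⊚ y := by
  have h := congrArg (fun z => z ⬝ y) (B_Tr x)
  simp only [comp_app] at h
  exact h.symm

/-- Expanding `dot (Tr ⬝ f)`, the arity of `Tr` lets `Tr` be pulled in front of `dot f`; the arity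
of `f` then applies, and right tightening in the form `B_Tr` absorbs `Tr` together with one factor
`B`. -/
theorem HasArity.Tr {f : A} {m n : ℕ} (h : HasArity f (m + 1) (n + 1)) :
    HasArity (Tr ⬝ f) m n := by
  have hT := arity_Tr (A := A)
  unfold HasArity at *
  rw [dot_mul, comp_assoc, comp_assoc, ← cpow_succ, show m + 1 + 1 = 2 + m by omega, cpow_add,
    comp_assoc_of (c := _) (d := _) hT, ← cpow_add, ← comp_assoc, ← comp_dot, comp_assoc,
    show 2 + m = m + 1 + 1 by omega, h, B_Tr, cpow_succ]
  simp only [comp_assoc]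

theorem HasArity.iterTr {f : A} {k m n : ℕ} (h : HasArity f (k + m) (k + n)) :
    HasArity (iterTr k f) m n := by
  induction k generalizing f with
  | zero => rwa [Nat.zero_add, Nat.zero_add] at h
  | succ k ih =>
    rw [iterTr_succ]
    refine ih (HasArity.Tr ?_)
    rwa [show k + m + 1 = k + 1 + m by omega, show k + n + 1 = k + 1 + n by omega]

theorem iterTr_comp_left (k : ℕ) (x y : A) :
    iterTr k (lwhisk k x ⊚ y) = x ⊚ iterTr k y := by
  induction k generalizing y with
  | zero => rfl
  | succ k ih => rw [iterTr_succ, lwhisk_succ, Tr_comp_left, ih, iterTr_succ]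

theorem iterTr_comp_right (k : ℕ) (x y : A) :
    iterTr k (x ⊚ lwhisk k y) = iterTr k x ⊚ y := by
  induction k generalizing x with
  | zero => rfl
  | succ k ih => rw [iterTr_succ, lwhisk_succ, Tr_comp_right, ih, iterTr_succ]

/-! ### Exchange: invariance under conjugation by braids -/

/-- The trace on the first `k` strands is invariant under `f ↦ u ∘ f ∘ v`. -/
def TrInvariant (k : ℕ) (u v : A) : Prop := ∀ f : A, iterTr k (u ⊚ f ⊚ v) = iterTr k f

theorem TrInvariant.comp {k : ℕ} {u u' v v' : A} (h : TrInvariant k u v)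
    (h' : TrInvariant k u' v') : TrInvariant k (u ⊚ u') (v' ⊚ v) := fun f => by
  rw [← h' f, ← h (u' ⊚ f ⊚ v')]
  simp only [comp_assoc]

/-- The additional strand lies to the right of the others and is traced last. -/
theorem TrInvariant.succ {k : ℕ} {u v : A} (h : TrInvariant k u v) :
    TrInvariant (k + 1) u v := fun f => by
  rw [iterTr_succ', iterTr_succ', h f]

/-- The additional strand lies to the left and is traced first; tightening strips one `B` from `u`
and from `v`. -/
theorem TrInvariant.B {k : ℕ} {u v : A} (h : TrInvariant k u v) :
    TrInvariant (k + 1) (B ⬝ u) (B ⬝ v) := fun f => by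
  rw [iterTr_succ, Tr_comp_left, Tr_comp_right, h, iterTr_succ]

theorem trInvariant_I (k : ℕ) : TrInvariant k (I : A) I := fun f => by rw [comp_I, I_comp]

theorem trInvariant_C (k : ℕ) : TrInvariant (k + 2) (C Sgn.pos : A) (C Sgn.neg) := by
  induction k with
  | zero =>
    intro f
    have h := congrArg (fun z => z ⬝ f) (exchange (A := A) Sgn.pos)
    simp only [comp_app, ax_C, cpow, ax_I] at h
    rw [← comp_assoc]
    exact h
  | succ k ih => exact ih.succ

theorem trInvariant_oneBraid (k m : ℕ) :
    TrInvariant (k + m + 1) (oneBraid Sgn.pos m : A) (braidOne Sgn.neg m) := by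
  induction m with
  | zero => exact trInvariant_I _
  | succ m ih =>
    refine ih.B.comp ?_
    exact trInvariant_C (k + m)

theorem trInvariant_braid (m n : ℕ) : TrInvariant (m + n) (braid m n : A) (braidInv m n) := by
  induction n with
  | zero => exact trInvariant_I _
  | succ n ih =>
    refine TrInvariant.comp ?_ ih.B
    -- The factor `σ_{m,1}` involves `m + 1` strands only; the other `n` are the idle ones.
    rw [show m + (n + 1) = n + m + 1 by omega]
    exact trInvariant_oneBraid _ _

/-! ### Yanking on several strands -/

/-- The hexagons isolate `σ_{m,m}`, and tracing `m` strands leaves `σ_{n,m+n} ∘ θ_m ∘ σ_{m,n}`.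
Naturality moves `θ_m ∘ σ_{m,n}` to the front, past the remaining `n` traced strands; yanking
`σ_{n,n}` then yields the formula `twist_add`. -/
theorem iterTr_braid_add {m n : ℕ} (hm : iterTr m (braid m m : A) = twist m)
    (hn : iterTr n (braid n n : A) = twist n) :
    iterTr (m + n) (braid (m + n) (m + n) : A) = twist (m + n) := by
  have e := braid_nat_right ((arity_twist (A := A) m).add n) n
  have e2 := braid_nat_right (arity_braid (A := A) m n) n
  rw [iterTr_add', braid_add_left, braid_add_right m m n, iterTr_comp_left,
    iterTr_comp_right, hm, ← comp_assoc_of e, ← e2, iterTr_comp_left, iterTr_comp_left,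
    braid_add_right n n m, iterTr_comp_right, hn, twist_add]

theorem iterTr_braid (n : ℕ) : iterTr n (braid n n : A) = twist n := by
  induction n with
  | zero => rfl
  | succ n ih =>
    refine iterTr_braid_add ih ?_
    rw [twist_one, iterTr_one, braid_one, oneBraid, oneBraid, B_I, I_comp, yanking]

theorem twistInv_one : (twistInv 1 : A) = θ Sgn.neg := by
  simp only [twistInv, braidInv, braidOne, B_I, I_comp]

theorem twistInv_add (m n : ℕ) :
    (twistInv (m + n) : A) = braidInv n m ⊚ twistInv n ⊚ braidInv m n ⊚ twistInv m := by
  refine inverse_unique (twistInv_twist (m + n)) ?_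
  rw [twist_add]
  simp only [comp_assoc]
  rw [cancel_mid (braid_braidInv n m), cancel_mid (twist_twistInv n),
    cancel_mid (braid_braidInv m n), twist_twistInv]

theorem iterTr_braidInv_add {m n : ℕ} (hm : iterTr m (braidInv m m : A) = twistInv m)
    (hn : iterTr n (braidInv n n : A) = twistInv n) :
    iterTr (m + n) (braidInv (m + n) (m + n) : A) = twistInv (m + n) := by
  -- Mirror image of `iterTr_braid_add`: here the factors leave the trace on the right.
  rw [iterTr_add', braidInv_add_left, braidInv_add_right m m n, comp_assoc, iterTr_comp_left,
    iterTr_comp_right, hm,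
    ← braidInv_nat_right ((arity_twistInv (A := A) m).add n) n, ← comp_assoc,
    ← braidInv_nat_right (arity_braidInv (A := A) m n) n, comp_assoc,
    ← lwhisk_comp, iterTr_comp_right, braidInv_add_right n n m, iterTr_comp_left, hn, twistInv_add]
  simp only [comp_assoc]

theorem iterTr_braidInv (n : ℕ) : iterTr n (braidInv n n : A) = twistInv n := by
  induction n with
  | zero => rfl
  | succ n ih =>
    refine iterTr_braidInv_add ih ?_
    rw [twistInv_one, iterTr_one, braidInv, braidInv, braidOne, braidOne]
    simp only [B_I, I_comp, comp_I, yanking]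

/-! ### Sliding -/

/-- Both sides compute one trace over `n + m` strands, the `m` block or the `n` block being yanked
first. Only `h` has to pass through braids, so `f` may be arbitrary. -/
theorem iterTr_slide_twist {h : A} {m n : ℕ} (hh : HasArity h m n) (f : A) :
    iterTr n (f ⊚ twist m ⊚ h) = iterTr m (h ⊚ twist n ⊚ f) := by
  have key := trInvariant_braid (A := A) n m (lwhisk m f ⊚ braid m m ⊚ lwhisk m h)
  -- Naturality at `h` turns `σ_{m,m}` into `σ_{n,m}`, which cancels on the right; interchange and
  -- naturality on the other side then create `σ_{n,n}`.
  have e : (braid n m : A) ⊚ (lwhisk m f ⊚ braid m m ⊚ lwhisk m h) ⊚ braidInv n m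
      = lwhisk n h ⊚ braid n n ⊚ lwhisk n f := by
    rw [← braid_nat_left hh]
    simp only [comp_assoc]
    rw [braid_braidInv, comp_I, hh.nat, comp_assoc_of (braid_nat_right hh n)]
  rw [e, iterTr_add' n m, iterTr_comp_left, iterTr_comp_right, iterTr_braid, iterTr_add,
    iterTr_comp_left, iterTr_comp_right, iterTr_braid] at key
  exact key.symm

theorem iterTr_slide {h : A} {m n : ℕ} (hh : HasArity h m n) (f : A) :
    iterTr n (f ⊚ h) = iterTr m (h ⊚ f) := by
  -- Sliding `θ_m⁻¹ ∘ h` instead of `h` cancels the twist on one side; on the other, `θ_m⁻¹ ∘ h ∘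
  -- θ_n = h` since the twist is natural.
  have key := iterTr_slide_twist ((arity_twistInv m).comp hh) f
  have e : (twistInv m : A) ⊚ h ⊚ twist n = h := by
    rw [show h ⊚ twist n = twist m ⊚ h from twistNat hh, ← comp_assoc, twistInv_twist, I_comp]
  rwa [comp_assoc, cancel_mid (twist_twistInv m), ← comp_assoc h, ← comp_assoc (twistInv m), e]
    at key

/-! ### The right trace and its axioms -/

/-- The right trace, obtained from the left trace by conjugating with the braid. -/
def rightTr (k m n : ℕ) (f : A) : A := iterTr k (braid k m ⊚ f ⊚ braidInv k n)

theorem HasArity.rightTr {f : A} {k m n : ℕ} (h : HasArity f (m + k) (n + k)) :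
    HasArity (rightTr k m n f) m n :=
  HasArity.iterTr ((arity_braid k m).comp (h.comp (arity_braidInv k n)))

theorem rightTr_tightening (k : ℕ) {m m' n n' : ℕ} {g h : A} (f : A) (hg : HasArity g m' m)
    (hh : HasArity h n n') :
    rightTr k m' n' (g ⊚ f ⊚ h) = g ⊚ rightTr k m n f ⊚ h := by
  unfold rightTr
  rw [comp_assoc, ← comp_assoc_of (braid_nat_right hg k), comp_assoc,
    ← braidInv_nat_right hh, iterTr_comp_left, ← comp_assoc f, ← comp_assoc (braid k m),
    iterTr_comp_right]

theorem rightTr_sliding {k l : ℕ} (m n : ℕ) {h : A} (f : A) (hh : HasArity h l k) :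
    rightTr k m n (f ⊚ lwhisk n h) = rightTr l m n (lwhisk m h ⊚ f) := by
  unfold rightTr
  rw [comp_assoc, ← braidInv_nat_left hh, ← comp_assoc f, ← comp_assoc (braid k m),
    iterTr_slide hh, comp_assoc, comp_assoc_of (braid_nat_left hh m).symm]

theorem rightTr_zero (m n : ℕ) (f : A) : rightTr 0 m n f = f := by
  have e : (braidInv 0 n : A) = I := by
    rw [← comp_I (braidInv 0 n), ← zero_braid n, braidInv_braid, zero_braid]
  rw [rightTr, zero_braid, e, comp_I, I_comp, iterTr_zero]

/-- By tightening, the nested trace is a single one over `k + l` strands, but with the blocks in the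
order `l`, `k`. It differs from the left side by conjugation with `σ_{l,k}`, which the trace does
not see. -/
theorem rightTr_add (k l m n : ℕ) (f : A) :
    rightTr (k + l) m n f = rightTr k m n (rightTr l (m + k) (n + k) f) := by
  have e1 : lwhisk l (braid k m : A) ⊚ braid l (m + k) = braid l k ⊚ braid (k + l) m := by
    rw [braid_nat_right (arity_braid k m), braid_add_right, braid_add_left, comp_assoc]
  have e2 : braidInv l (n + k) ⊚ lwhisk l (braidInv k n : A)
      = braidInv (k + l) n ⊚ braidInv l k := by
    rw [braidInv_nat_right (arity_braidInv k n), braidInv_add_right, braidInv_add_left,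
      comp_assoc]
  have key := trInvariant_braid (A := A) l k (braid (k + l) m ⊚ f ⊚ braidInv (k + l) n)
  unfold rightTr
  rw [← iterTr_comp_right, ← iterTr_comp_left, ← iterTr_add]
  simp only [comp_assoc] at key ⊢
  rw [e2, comp_assoc_of e1, iterTr_add, ← iterTr_add' l k, ← key, iterTr_add', ← iterTr_add k l]

/-- Whiskering by `l` is written as conjugation by a braid. The part crossing the `k` traced strands
cancels, and the part crossing the other strands leaves the trace by tightening, where it
reassembles into whiskering of the result. -/
theorem rightTr_superposing (k l : ℕ) {m n : ℕ} {f : A} (h : HasArity f (m + k) (n + k)) :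
    rightTr k (l + m) (l + n) (lwhisk l f) = lwhisk l (rightTr k m n f) := by
  have hg : HasArity (braid k m ⊚ f ⊚ braidInv k n) (k + m) (k + n) :=
    (arity_braid k m).comp (h.comp (arity_braidInv k n))
  have e : lwhisk l (braid k m ⊚ f ⊚ braidInv k n)
      = braidInv k l ⊚ lwhisk k (braidInv m l) ⊚ (braid k m ⊚ f ⊚ braidInv k n)
        ⊚ lwhisk k (braid n l) ⊚ braid k l := by
    rw [lwhisk_eq_conj hg, braidInv_add_left, braid_add_left, comp_assoc]
  have e' : braid k (l + m) ⊚ lwhisk l f ⊚ braidInv k (l + n)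
      = lwhisk k (braidInv m l) ⊚ (braid k m ⊚ f ⊚ braidInv k n) ⊚ lwhisk k (braid n l) := by
    rw [braid_add_right, braidInv_add_right]
    calc _ = braid k l ⊚ lwhisk l (braid k m ⊚ f ⊚ braidInv k n) ⊚ braidInv k l := by
          simp only [lwhisk_comp, comp_assoc]
      _ = _ := by
          rw [e]
          simp only [comp_assoc]
          rw [braid_braidInv, comp_I, ← comp_assoc, braid_braidInv, I_comp]
  rw [lwhisk_eq_conj (HasArity.rightTr h)]
  unfold rightTr
  rw [e', iterTr_comp_left, iterTr_comp_right]

theorem rightTr_braid (k : ℕ) : rightTr k k k (braid k k : A) = twist k := by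
  rw [rightTr, braid_braidInv, comp_I, iterTr_braid]

theorem rightTr_braidInv (k : ℕ) : rightTr k k k (braidInv k k : A) = twistInv k := by
  rw [rightTr, ← comp_assoc, braid_braidInv, I_comp, iterTr_braidInv]

theorem rightTr_conj (k m n : ℕ) (f : A) :
    rightTr k m n (braidInv k m ⊚ f ⊚ braid k n) = iterTr k f := by
  rw [rightTr]
  simp only [comp_assoc]
  rw [braid_braidInv, comp_I, ← comp_assoc, braid_braidInv, I_comp]

end Trace

end BCI

/-! ### The traced structure on the internal PROB -/

namespace InternalPROB
open BCI BCISignature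

/-- The trace of the internal PROB. -/
def monoidalTrace (A : Type u) [TracedExtBCIAlgebra A] : MonoidalTrace (InternalPROB A) where
  tr X m n f := ⟨rightTr X.arity m.arity n.arity f.1, HasArity.rightTr f.2⟩
  tightening X _ _ _ _ g f h := hom_ext (rightTr_tightening X.arity f.1 g.2 h.2)
  sliding {_ _ m n} f h := hom_ext (rightTr_sliding m.arity n.arity f.1 h.2)
  vanishing_unit {m n} f := hom_ext <| by
    change rightTr 0 m.arity n.arity f.1 = I ⊚ f.1 ⊚ I
    rw [rightTr_zero, comp_I, I_comp]
  vanishing_tensor X Y m n f := hom_ext <| by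
    change rightTr (X.arity + Y.arity) m.arity n.arity f.1 = rightTr X.arity m.arity n.arity
      (rightTr Y.arity (m.arity + X.arity) (n.arity + X.arity) (I ⊚ f.1 ⊚ I))
    rw [comp_I, I_comp, rightTr_add]
  superposing X Z m n f := hom_ext <| by
    change rightTr X.arity (Z.arity + m.arity) (Z.arity + n.arity)
      (I ⊚ lwhisk Z.arity f.1 ⊚ I) = lwhisk Z.arity (rightTr X.arity m.arity n.arity f.1)
    rw [comp_I, I_comp, rightTr_superposing X.arity Z.arity f.2]
  yanking X := hom_ext (rightTr_braid X.arity)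
  yanking_inv X := hom_ext (rightTr_braidInv X.arity)

end InternalPROB

theorem mainTheorem7 {A : Type u} [TracedExtBCIAlgebra A] :
    ∃ T : MonoidalTrace (InternalPROB A),
      ∀ (k m n : InternalPROB A) (f : k ⊗ m ⟶ k ⊗ n),
        (T.leftTr k f).1 = (fun a : A => TracedExtBCIAlgebra.Tr ⬝ a)^[k.arity] f.1 :=
  -- The conjugation in `leftTr` is inverse to the one in `rightTr`.
  ⟨InternalPROB.monoidalTrace A, fun k m n f =>
    BCI.rightTr_conj k.arity m.arity n.arity f.1⟩
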